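/- **Theorem (Unbiased estimates ensure optimality).** Consider a finite discounted MDP with state space $\mathcal S$, action space $\mathcal A$, transition probabilities $p(s'\mid s,a)$ and discount factor $\gamma\in[0,1)$. Let $(R_\theta)_{\theta\in\Theta}$ be a family of reward functions $R_\theta:\mathcal S\times\mathcal A\to\mathbb R$, measurable in $\theta$, and let $\mathcal B\in\Theta$ be the true parameter. On a probability space with a filtration $(\mathcal F_t)_{t\ge 0}$ let $(s_t,a_t)_{t\ge0}$ be an $\mathcal F_t$-adapted trajectory of the MDP, i.e. $\mathbb P(s_{t+1}=s'\mid\mathcal F_t)=p(s'\mid s_t,a_t)$ almost surely for all $t$ and $s'$ (the actions may be chosen by any rule). At each time $t$ let $\tilde{\mathcal B}_t$ be an $\mathcal F_{t+1}$-measurable random parameter, such that the estimated reward is square-integrable, unbiased given the past, and has conditional variance bounded uniformly in $t$ by a constant $C$: $$\mathbb E[R_{\tilde{\mathcal B}_t}(s_t,a_t)\mid\mathcal F_t]=R_{\mathcal B}(s_t,a_t),\qquad \operatorname{Var}(R_{\tilde{\mathcal B}_t}(s_t,a_t)\mid\mathcal F_t)\le C\quad\text{a.s.}$$ Let the step sizes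 $\alpha_t$ be $\mathcal F_t$-measurable with values in $[0,1]$ almost surely, put $\alpha_t(s,a)=\alpha_t$ if $(s,a)=(s_t,a_t)$ and $\alpha_t(s,a)=0$ otherwise, and assume that for every pair $(s,a)\in\mathcal S\times\mathcal A$, almost surely, $$\sum_t\alpha_t(s,a)=\infty,\qquad \sum_t\alpha_t(s,a)^2<\infty .$$ Starting from an arbitrary table $Q_0:\mathcal S\times\mathcal A\to\mathbb R$, define the Q-learning iterates by $$Q_{t+1}(s_t,a_t)=(1-\alpha_t)\,Q_t(s_t,a_t)+\alpha_t\Big[R_{\tilde{\mathcal B}_t}(s_t,a_t)+\gamma\max_{b\in\mathcal A}Q_t(s_{t+1},b)\Big]$$ and $Q_{t+1}(s,a)=Q_t(s,a)$ for $(s,a)\ne(s_t,a_t)$. Then, with probability $1$, $Q_t(s,a)\to Q^*_{\mathcal B}(s,a)$ for all $(s,a)$, where $$Q^*_{\mathcal B}(s,a)=\sup_\pi\ \mathbb E_\pi\Big[\sum_{t\ge0}\gamma^tR_{\mathcal B}(S_t,A_t)\,\Big|\,S_0=s,A_0=a\Big]$$ is the optimal Q-function of the true reward $R_{\mathcal B}$,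 the supremum being over all stationary randomized policies. -/

import Mathlib

open MeasureTheory ProbabilityTheory Filter Topology

/-- The dynamics of a discounted Markov decision process with (joint) state space `S` and (joint)
action space `A`: transition probabilities and a discount factor in `[0, 1)`. The reward function
`S → A → ℝ` is kept separate, since the same dynamics are considered with several rewards. -/
structure DiscountedMDP (S A : Type*) where
  /-- `trans s a` is the law of the next state after taking action `a` in state `s`. -/
  trans : S → A → PMF S
  /-- The discount factor. -/
  γ : ℝ
  γ_nonneg : 0 ≤ γ
  γ_lt_one : γ < 1

namespace DiscountedMDP

variable {S A : Type*}

/-- The law of the state-action pair `(S_t, A_t)` when `(S_0, A_0) = (s, a)` and all later actions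
are drawn from the (stationary, randomized) policy `π`. -/
noncomputable def stateActionLaw (M : DiscountedMDP S A) (π : S → PMF A) (s : S) (a : A) :
    ℕ → PMF (S × A)
  | 0 => PMF.pure (s, a)
  | t + 1 => (M.stateActionLaw π s a t).bind fun z =>
      (M.trans z.1 z.2).bind fun s' => (π s').map fun b => (s', b)

/-- The action-value function `Q^π(s, a) = E_π[∑_t γ^t R(S_t, A_t) | S_0 = s, A_0 = a]`. -/
noncomputable def qValue [Fintype S] [Fintype A] (M : DiscountedMDP S A) (R : S → A → ℝ)
    (π : S → PMF A) (s : S) (a : A) : ℝ :=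
  ∑' t : ℕ, M.γ ^ t * ∑ z : S × A, (M.stateActionLaw π s a t z).toReal * R z.1 z.2

/-- The optimal Q-function `Q^*(s, a) = sup_π Q^π(s, a)` for the reward function `R`. -/
noncomputable def optimalQ [Fintype S] [Fintype A] (M : DiscountedMDP S A) (R : S → A → ℝ)
    (s : S) (a : A) : ℝ :=
  ⨆ π : S → PMF A, M.qValue R π s a

end DiscountedMDP

open Classical in
/-- The step size with which the entry `(x, u)` of the Q-table is updated at time `t`: it is `α t`
if `(x, u)` is the pair visited at time `t`, and `0` otherwise. -/
noncomputable def entryStep {S A : Type*} (s : ℕ → S) (a : ℕ → A) (α : ℕ → ℝ)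
    (x : S) (u : A) (t : ℕ) : ℝ :=
  if x = s t ∧ u = a t then α t else 0

open Classical in
/-- The Q-learning iterates along a trajectory with states `s t`, actions `a t`, step sizes `α t`
and observed rewards `r t`, started from the table `Q₀`. At time `t` only the entry of the visited
pair `(s t, a t)` changes. -/
noncomputable def qLearning {S A : Type*} (γ : ℝ) (Q₀ : S → A → ℝ)
    (s : ℕ → S) (a : ℕ → A) (α r : ℕ → ℝ) : ℕ → S → A → ℝ
  | 0 => Q₀
  | t + 1 => fun x u =>
      if x = s t ∧ u = a t then
        (1 - α t) * qLearning γ Q₀ s a α r t x u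
          + α t * (r t + γ * ⨆ b : A, qLearning γ Q₀ s a α r t (s (t + 1)) b)
      else qLearning γ Q₀ s a α r t x u

/-- `(s t, a t)` is a trajectory of the MDP `M` with respect to the filtration `ℱ`: states and
actions are adapted (actions may be chosen by any rule that uses the past and extra randomness),
and given the past the next state has law `M.trans (s t) (a t)`. -/
structure IsTrajectory {S A Ω : Type*} [MeasurableSpace S] [MeasurableSpace A]
    {mΩ : MeasurableSpace Ω} (M : DiscountedMDP S A) (μ : Measure Ω) (ℱ : Filtration ℕ mΩ)
    (s : ℕ → Ω → S) (a : ℕ → Ω → A) : Prop where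
  measurable_state : ∀ t, Measurable[ℱ t] (s t)
  measurable_action : ∀ t, Measurable[ℱ t] (a t)
  condProb_next : ∀ t (y : S),
    μ⟦s (t + 1) ⁻¹' {y} | ℱ t⟧ =ᵐ[μ] fun ω => (M.trans (s t ω) (a t ω) y).toReal

/-! Every entry of the table is an averaging recursion with weight `entryStep`, whose target is the
Bellman operator applied to the current table plus two noises: the reward error, and γ times the
transition error (maximum at the sampled next state minus its mean). The recursion is linear in the
noise, so subtracting the moving averages `N` and `W` of these errors leaves a noise-free recursion
for `Z = Q - N - γ W`. The operator contracts towards `optimalQ`, its fixed point; an asymptotic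
error bound for `Z` therefore improves by nearly the factor γ, and the least one is 0
(`tendsto_of_perturbed_contraction`).

The averages vanish once the weighted noise series converge (`tendsto_movingAverage_zero`), which is
martingale convergence after truncating the weights (`ae_exists_tendsto_sum_mul`). The transition
error scales with the table, so boundedness comes first; it needs only the reward noise to be
controlled (`exists_forall_abs_qLearning_le`). -/

section FiniteMax

variable {A : Type*} [Fintype A] [Nonempty A]

theorem abs_ciSup_sub_ciSup_le {f g : A → ℝ} {D : ℝ} (h : ∀ b, |f b - g b| ≤ D) :
    |(⨆ b, f b) - ⨆ b, g b| ≤ D := by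
  have hf : BddAbove (Set.range f) := (Set.finite_range f).bddAbove
  have hg : BddAbove (Set.range g) := (Set.finite_range g).bddAbove
  rw [abs_sub_le_iff]
  constructor
  · have : (⨆ b, f b) ≤ (⨆ b, g b) + D := ciSup_le fun b => by
      have h1 := (abs_sub_le_iff.1 (h b)).1
      have h2 := le_ciSup hg b
      linarith
    linarith
  · have : (⨆ b, g b) ≤ (⨆ b, f b) + D := ciSup_le fun b => by
      have h1 := (abs_sub_le_iff.1 (h b)).2
      have h2 := le_ciSup hf b
      linarith
    linarith

theorem abs_ciSup_le {f : A → ℝ} {D : ℝ} (h : ∀ b, |f b| ≤ D) : |⨆ b, f b| ≤ D := by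
  have := abs_ciSup_sub_ciSup_le (f := f) (g := fun _ => 0) (D := D) (by simpa using h)
  simpa using this

end FiniteMax

/-! ### Means under finite probability mass functions -/

namespace PMF

variable {X Y : Type*} [Fintype X] [Fintype Y]

/-- The mean of a real function under a probability mass function on a finite type. -/
noncomputable def mean (p : PMF X) (f : X → ℝ) : ℝ := ∑ x, (p x).toReal * f x

theorem sum_toReal (p : PMF X) : ∑ x, (p x).toReal = 1 := by
  have h := p.tsum_coe
  rw [tsum_fintype] at h
  rw [← ENNReal.toReal_sum fun x _ => p.apply_ne_top x, h, ENNReal.toReal_one]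

theorem mean_const (p : PMF X) (c : ℝ) : p.mean (fun _ => c) = c := by
  rw [mean, ← Finset.sum_mul, sum_toReal, one_mul]

theorem mean_mono (p : PMF X) {f g : X → ℝ} (h : ∀ x, f x ≤ g x) : p.mean f ≤ p.mean g :=
  Finset.sum_le_sum fun x _ => mul_le_mul_of_nonneg_left (h x) ENNReal.toReal_nonneg

theorem mean_sub (p : PMF X) (f g : X → ℝ) :
    p.mean (fun x => f x - g x) = p.mean f - p.mean g := by
  simp only [mean, mul_sub, Finset.sum_sub_distrib]

theorem mean_const_mul (p : PMF X) (c : ℝ) (f : X → ℝ) :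
    p.mean (fun x => c * f x) = c * p.mean f := by
  simp only [mean, Finset.mul_sum]
  exact Finset.sum_congr rfl fun x _ => by ring

theorem abs_mean_le (p : PMF X) {f : X → ℝ} {D : ℝ} (h : ∀ x, |f x| ≤ D) : |p.mean f| ≤ D := by
  rw [abs_le]
  constructor
  · rw [← p.mean_const (-D)]
    exact p.mean_mono fun x => (abs_le.1 (h x)).1
  · rw [← p.mean_const D]
    exact p.mean_mono fun x => (abs_le.1 (h x)).2

theorem abs_mean_sub_mean_le (p : PMF X) {f g : X → ℝ} {D : ℝ} (h : ∀ x, |f x - g x| ≤ D) :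
    |p.mean f - p.mean g| ≤ D := by
  rw [← mean_sub]
  exact p.abs_mean_le h

theorem mean_bind (p : PMF X) (k : X → PMF Y) (f : Y → ℝ) :
    (p.bind k).mean f = p.mean fun x => (k x).mean f := by
  have h : ∀ y, ((p.bind k) y).toReal = ∑ x, (p x).toReal * (k x y).toReal := fun y => by
    rw [bind_apply, tsum_fintype, ENNReal.toReal_sum fun x _ =>
      ENNReal.mul_ne_top (p.apply_ne_top x) ((k x).apply_ne_top y)]
    simp only [ENNReal.toReal_mul]
  simp only [mean, h, Finset.sum_mul, Finset.mul_sum]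
  rw [Finset.sum_comm]
  exact Finset.sum_congr rfl fun x _ => Finset.sum_congr rfl fun y _ => by ring

theorem mean_pure (x : X) (f : X → ℝ) : (PMF.pure x).mean f = f x := by
  classical
  rw [mean, Finset.sum_eq_single x]
  · simp
  · intro y _ hy
    simp [PMF.pure_apply, hy]
  · simp

theorem mean_map (p : PMF X) (g : X → Y) (f : Y → ℝ) :
    (p.map g).mean f = p.mean fun x => f (g x) := by
  rw [← bind_pure_comp, mean_bind]
  simp only [Function.comp_apply, mean_pure]

end PMF

/-! ### Bellman operator and optimal Q-function -/

namespace DiscountedMDP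

variable {S A : Type*} [Fintype S] [Fintype A]

/-- The Bellman optimality operator of the MDP `M` with reward function `R`. -/
noncomputable def bellman (M : DiscountedMDP S A) (R q : S → A → ℝ) (x : S) (u : A) : ℝ :=
  R x u + M.γ * (M.trans x u).mean fun y => ⨆ b, q y b

variable (M : DiscountedMDP S A) (R : S → A → ℝ)

theorem abs_bellman_sub_bellman_le [Nonempty A] {q q' : S → A → ℝ} {D : ℝ}
    (h : ∀ x u, |q x u - q' x u| ≤ D) (x : S) (u : A) :
    |M.bellman R q x u - M.bellman R q' x u| ≤ M.γ * D := by
  rw [bellman, bellman, add_sub_add_left_eq_sub, ← mul_sub, abs_mul, abs_of_nonneg M.γ_nonneg]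
  exact mul_le_mul_of_nonneg_left ((M.trans x u).abs_mean_sub_mean_le fun y =>
    abs_ciSup_sub_ciSup_le fun b => h y b) M.γ_nonneg

theorem exists_bellman_eq_self [Nonempty A] : ∃ q : S → A → ℝ, M.bellman R q = q := by
  have hc : ContractingWith ⟨M.γ, M.γ_nonneg⟩ (M.bellman R) := by
    refine ⟨M.γ_lt_one, LipschitzWith.of_dist_le_mul fun q q' => ?_⟩
    have hD : 0 ≤ M.γ * dist q q' := mul_nonneg M.γ_nonneg dist_nonneg
    refine (dist_pi_le_iff hD).2 fun x => (dist_pi_le_iff hD).2 fun u => ?_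
    rw [Real.dist_eq]
    refine M.abs_bellman_sub_bellman_le R (fun y b => ?_) x u
    rw [← Real.dist_eq]
    exact (dist_le_pi_dist (q y) (q' y) b).trans (dist_le_pi_dist q q' y)
  exact ⟨hc.fixedPoint, hc.fixedPoint_isFixedPt⟩

theorem mean_stateActionLaw_succ (π : S → PMF A) (x : S) (u : A) (t : ℕ) (f : S × A → ℝ) :
    (M.stateActionLaw π x u (t + 1)).mean f =
      (M.stateActionLaw π x u t).mean fun z =>
        (M.trans z.1 z.2).mean fun y => (π y).mean fun b => f (y, b) := by
  simp only [stateActionLaw, PMF.mean_bind, PMF.mean_map]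

theorem hasSum_qValue (π : S → PMF A) (x : S) (u : A) :
    HasSum (fun t : ℕ => M.γ ^ t * (M.stateActionLaw π x u t).mean fun z => R z.1 z.2)
      (M.qValue R π x u) := by
  obtain ⟨D, hD⟩ := (Set.finite_range fun z : S × A => |R z.1 z.2|).bddAbove
  refine Summable.hasSum (f := fun t : ℕ =>
    M.γ ^ t * (M.stateActionLaw π x u t).mean fun z => R z.1 z.2) ?_
  refine Summable.of_norm_bounded (g := fun t => M.γ ^ t * D)
    ((summable_geometric_of_lt_one M.γ_nonneg M.γ_lt_one).mul_right D) fun t => ?_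
  rw [Real.norm_eq_abs, abs_mul, abs_of_nonneg (pow_nonneg M.γ_nonneg t)]
  exact mul_le_mul_of_nonneg_left (PMF.abs_mean_le _ fun z => hD ⟨z, rfl⟩)
    (pow_nonneg M.γ_nonneg t)

/-- Consecutive discounted means of `q` along the trajectory cancel. Any table is thus the value of
the reward `q - γ P^π q`, which reduces comparing `qValue` with `q` to comparing rewards termwise.
-/
theorem hasSum_telescope (q : S → A → ℝ) (π : S → PMF A) (x : S) (u : A) :
    HasSum (fun t : ℕ => M.γ ^ t * (M.stateActionLaw π x u t).mean fun z =>
      q z.1 z.2 - M.γ * (M.trans z.1 z.2).mean fun y => (π y).mean fun b => q y b)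
      (q x u) := by
  set E : ℕ → ℝ := fun t => (M.stateActionLaw π x u t).mean fun z => q z.1 z.2 with hE
  have key : ∀ t, (M.γ ^ t * (M.stateActionLaw π x u t).mean fun z =>
      q z.1 z.2 - M.γ * (M.trans z.1 z.2).mean fun y => (π y).mean fun b => q y b)
      = M.γ ^ t * E t - M.γ ^ (t + 1) * E (t + 1) := fun t => by
    rw [PMF.mean_sub, PMF.mean_const_mul, hE]
    simp only [mean_stateActionLaw_succ]
    ring
  obtain ⟨D, hD⟩ := (Set.finite_range fun z : S × A => |q z.1 z.2|).bddAbove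
  have hb : ∀ t, |E t| ≤ D := fun t => PMF.abs_mean_le _ fun z => hD ⟨z, rfl⟩
  have hs : Summable fun t => M.γ ^ t * E t := by
    refine Summable.of_norm_bounded (g := fun t => M.γ ^ t * D)
      ((summable_geometric_of_lt_one M.γ_nonneg M.γ_lt_one).mul_right D) fun t => ?_
    rw [Real.norm_eq_abs, abs_mul, abs_of_nonneg (pow_nonneg M.γ_nonneg t)]
    exact mul_le_mul_of_nonneg_left (hb t) (pow_nonneg M.γ_nonneg t)
  have h0 : E 0 = q x u := by simp only [hE, stateActionLaw, PMF.mean_pure]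
  have h := hs.hasSum.sub (((hasSum_nat_add_iff' 1).2 hs.hasSum))
  simp only [key]
  simpa [h0] using h

variable {M R}

theorem qValue_le_of_bellman_eq_self {q : S → A → ℝ} (hq : M.bellman R q = q)
    (π : S → PMF A) (x : S) (u : A) : M.qValue R π x u ≤ q x u := by
  refine hasSum_le (fun t => ?_) (M.hasSum_qValue R π x u) (M.hasSum_telescope q π x u)
  refine mul_le_mul_of_nonneg_left (PMF.mean_mono _ fun z => ?_) (pow_nonneg M.γ_nonneg t)
  have h1 : q z.1 z.2 = R z.1 z.2 + M.γ * (M.trans z.1 z.2).mean fun y => ⨆ b, q y b :=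
    (congrFun (congrFun hq z.1) z.2).symm
  have h2 : ((M.trans z.1 z.2).mean fun y => (π y).mean fun b => q y b) ≤
      (M.trans z.1 z.2).mean fun y => ⨆ b, q y b := by
    refine PMF.mean_mono _ fun y => ?_
    rw [← (π y).mean_const (⨆ b, q y b)]
    exact PMF.mean_mono _ fun b => le_ciSup (Set.finite_range (q y)).bddAbove b
  have h3 := mul_le_mul_of_nonneg_left h2 M.γ_nonneg
  linarith

/-- The greedy policy attains each maximum, so the termwise inequality behind
`qValue_le_of_bellman_eq_self` becomes an equality. -/
theorem exists_qValue_eq_of_bellman_eq_self [Nonempty A] {q : S → A → ℝ}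
    (hq : M.bellman R q = q) : ∃ π : S → PMF A, ∀ x u, M.qValue R π x u = q x u := by
  choose g hg using fun y => exists_eq_ciSup_of_finite (f := q y)
  refine ⟨fun y => PMF.pure (g y), fun x u => ?_⟩
  refine (M.hasSum_qValue R _ x u).unique ?_
  convert M.hasSum_telescope q (fun y => PMF.pure (g y)) x u using 6 with t z
  have h1 : q z.1 z.2 = R z.1 z.2 + M.γ * (M.trans z.1 z.2).mean fun y => ⨆ b, q y b :=
    (congrFun (congrFun hq z.1) z.2).symm
  simp only [PMF.mean_pure, hg]
  linarith

theorem optimalQ_eq_of_bellman_eq_self [Nonempty A] {q : S → A → ℝ}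
    (hq : M.bellman R q = q) : M.optimalQ R = q := by
  obtain ⟨π, hπ⟩ := exists_qValue_eq_of_bellman_eq_self hq
  have : Nonempty (S → PMF A) := ⟨π⟩
  ext x u
  refine le_antisymm (ciSup_le fun π' => qValue_le_of_bellman_eq_self hq π' x u) ?_
  rw [← hπ x u]
  exact le_ciSup (f := fun π' => M.qValue R π' x u)
    ⟨q x u, by rintro _ ⟨π', rfl⟩; exact qValue_le_of_bellman_eq_self hq π' x u⟩ π

theorem bellman_optimalQ [Nonempty A] (M : DiscountedMDP S A) (R : S → A → ℝ) :
    M.bellman R (M.optimalQ R) = M.optimalQ R := by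
  obtain ⟨q, hq⟩ := M.exists_bellman_eq_self R
  rw [optimalQ_eq_of_bellman_eq_self hq, hq]

end DiscountedMDP

/-! ### Deterministic averaging recursions -/

section StochasticApproximation

variable {a : ℕ → ℝ}

/-- The excess over `D` is multiplied by at most `1 - a t ≤ exp (-a t)` at each step, and the
weights have infinite sum. -/
theorem eventually_le_of_averaging_le (ha : ∀ t, 0 ≤ a t ∧ a t ≤ 1)
    (hsum : Tendsto (fun n => ∑ t ∈ Finset.range n, a t) atTop atTop) {z : ℕ → ℝ} {D : ℝ}
    (hz : ∀ᶠ t in atTop, z (t + 1) ≤ (1 - a t) * z t + a t * D) {ε : ℝ} (hε : 0 < ε) :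
    ∀ᶠ t in atTop, z t ≤ D + ε := by
  obtain ⟨T, hT⟩ := eventually_atTop.1 hz
  set σ : ℕ → ℝ := fun n => ∑ t ∈ Finset.range n, a t with hσ
  set K : ℝ := |z T - D| * Real.exp (σ T) with hK
  have hK0 : 0 ≤ K := by positivity
  have hdecay : ∀ t, T ≤ t → z t - D ≤ K * Real.exp (-σ t) := by
    intro t ht
    induction t, ht using Nat.le_induction with
    | base =>
      rw [hK, mul_assoc, ← Real.exp_add, add_neg_cancel, Real.exp_zero, mul_one]
      exact le_abs_self _
    | succ t ht ih =>
      have h1 : 1 - a t ≤ Real.exp (-a t) := by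
        have := Real.add_one_le_exp (-a t)
        linarith
      have h2 : σ (t + 1) = σ t + a t := Finset.sum_range_succ _ _
      calc z (t + 1) - D ≤ (1 - a t) * (z t - D) := by linarith [hT t ht]
        _ ≤ (1 - a t) * (K * Real.exp (-σ t)) :=
          mul_le_mul_of_nonneg_left ih (by linarith [(ha t).2])
        _ ≤ Real.exp (-a t) * (K * Real.exp (-σ t)) :=
          mul_le_mul_of_nonneg_right h1 (by positivity)
        _ = K * Real.exp (-σ (t + 1)) := by
          rw [h2, neg_add, Real.exp_add]
          ring
  have hlim : Tendsto (fun t => K * Real.exp (-σ t)) atTop (𝓝 0) := by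
    simpa using (Real.tendsto_exp_neg_atTop_nhds_zero.comp hsum).const_mul K
  filter_upwards [hlim.eventually (gt_mem_nhds hε), eventually_ge_atTop T] with t h1 h2
  linarith [hdecay t h2]

/-- The sequence started at `0` and moved at time `t` towards `e t` by the fraction `a t`. -/
def movingAverage (a e : ℕ → ℝ) : ℕ → ℝ
  | 0 => 0
  | t + 1 => (1 - a t) * movingAverage a e t + a t * e t

/-- Adding the tail `l - m t` of the noise series to the average gives a sequence that averages
towards that same tail, which tends to 0. -/
theorem tendsto_movingAverage_zero (ha : ∀ t, 0 ≤ a t ∧ a t ≤ 1)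
    (hsum : Tendsto (fun n => ∑ t ∈ Finset.range n, a t) atTop atTop) {e : ℕ → ℝ} {l : ℝ}
    (he : Tendsto (fun n => ∑ t ∈ Finset.range n, a t * e t) atTop (𝓝 l)) :
    Tendsto (movingAverage a e) atTop (𝓝 0) := by
  set m : ℕ → ℝ := fun n => ∑ t ∈ Finset.range n, a t * e t with hm
  have hm0 : Tendsto (fun t => l - m t) atTop (𝓝 0) := by simpa using he.const_sub l
  have hrec : ∀ t, movingAverage a e (t + 1) + (l - m (t + 1)) =
      (1 - a t) * (movingAverage a e t + (l - m t)) + a t * (l - m t) := fun t => by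
    have : m (t + 1) = m t + a t * e t := Finset.sum_range_succ _ _
    rw [this, movingAverage]
    ring
  have hv : Tendsto (fun t => movingAverage a e t + (l - m t)) atTop (𝓝 0) := by
    rw [Metric.tendsto_atTop']
    intro ε hε
    have hb : ∀ᶠ t in atTop, |l - m t| < ε / 3 := by
      have := hm0.abs
      rw [abs_zero] at this
      exact this.eventually (gt_mem_nhds (by positivity))
    have key := eventually_le_of_averaging_le ha hsum
      (z := fun t => |movingAverage a e t + (l - m t)|) (D := ε / 3) (by
        filter_upwards [hb] with t ht
        rw [hrec]
        refine (abs_add_le _ _).trans ?_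
        rw [abs_mul, abs_mul, abs_of_nonneg (ha t).1,
          abs_of_nonneg (sub_nonneg.2 (ha t).2)]
        gcongr
        exact (ha t).1) (ε := ε / 3) (by positivity)
    obtain ⟨N, hN⟩ := eventually_atTop.1 key
    refine ⟨N, fun t ht => ?_⟩
    rw [Real.dist_eq, sub_zero]
    linarith [hN t ht.le]
  simpa using hv.sub hm0

theorem tendsto_of_perturbed_contraction {X U : Type*} [Finite X] [Finite U] {γ : ℝ}
    (hγ0 : 0 ≤ γ) (hγ1 : γ < 1) {c : X → U → ℕ → ℝ} (hc : ∀ x u t, 0 ≤ c x u t ∧ c x u t ≤ 1)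
    (hsum : ∀ x u, Tendsto (fun n => ∑ t ∈ Finset.range n, c x u t) atTop atTop)
    {T : (X → U → ℝ) → X → U → ℝ} {p : X → U → ℝ}
    (hT : ∀ q D, (∀ x u, |q x u - p x u| ≤ D) → ∀ x u, |T q x u - p x u| ≤ γ * D)
    {Q Z : ℕ → X → U → ℝ} {K : ℝ} (hbdd : ∀ t x u, |Z t x u| ≤ K)
    (hZ : ∀ t x u, Z (t + 1) x u = (1 - c x u t) * Z t x u + c x u t * T (Q t) x u)
    (hQZ : ∀ x u, Tendsto (fun t => Q t x u - Z t x u) atTop (𝓝 0)) (x : X) (u : U) :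
    Tendsto (fun t => Q t x u) atTop (𝓝 (p x u)) := by
  -- `B` is the set of asymptotic bounds for the error; its infimum turns out to be `0`
  set B : Set ℝ := {D | ∀ᶠ t in atTop, ∀ x u, |Z t x u - p x u| ≤ D} with hB
  have hB0 : ∀ D ∈ B, 0 ≤ D := fun D hD => by
    obtain ⟨t, ht⟩ := hD.exists
    exact (abs_nonneg _).trans (ht x u)
  have hBne : B.Nonempty := by
    obtain ⟨P, hP⟩ := (Set.finite_range fun z : X × U => |p z.1 z.2|).bddAbove
    refine ⟨K + P, Eventually.of_forall fun t x u => ?_⟩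
    exact (abs_sub _ _).trans (add_le_add (hbdd t x u) (hP ⟨(x, u), rfl⟩))
  have hstep : ∀ D ∈ B, ∀ ε > 0, γ * (D + ε) + ε ∈ B := by
    intro D hD ε hε
    have hQ : ∀ᶠ t in atTop, ∀ x u, |Q t x u - Z t x u| < ε := by
      refine eventually_all.2 fun x => eventually_all.2 fun u => ?_
      have := (hQZ x u).abs
      rw [abs_zero] at this
      exact this.eventually (gt_mem_nhds hε)
    refine eventually_all.2 fun x => eventually_all.2 fun u => ?_
    refine eventually_le_of_averaging_le (hc x u) (hsum x u)
      (z := fun t => |Z t x u - p x u|) ?_ hε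
    filter_upwards [hQ, hD] with t h1 h2
    have h3 : |T (Q t) x u - p x u| ≤ γ * (D + ε) := hT _ _ (fun y b => by
      have := abs_sub_le (Q t y b) (Z t y b) (p y b)
      linarith [h1 y b, h2 y b]) x u
    have h4 : Z (t + 1) x u - p x u =
        (1 - c x u t) * (Z t x u - p x u) + c x u t * (T (Q t) x u - p x u) := by
      rw [hZ]
      ring
    rw [h4]
    refine (abs_add_le _ _).trans ?_
    rw [abs_mul, abs_mul, abs_of_nonneg (hc x u t).1, abs_of_nonneg (sub_nonneg.2 (hc x u t).2)]
    gcongr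
    exact (hc x u t).1
  have hBb : BddBelow B := ⟨0, hB0⟩
  have hinf : sInf B ≤ 0 := by
    by_contra! hpos
    -- For `D < sInf B + ε` the improved bound is at most `γ * sInf B + 3 * ε`, which is below `sInf
    -- B` for this `ε`.
    set ε : ℝ := (1 - γ) * sInf B / 4 with hε
    have hεpos : 0 < ε := by
      have : 0 < 1 - γ := by linarith
      positivity
    obtain ⟨D, hD, hlt⟩ := exists_lt_of_csInf_lt hBne (show sInf B < sInf B + ε by linarith)
    have h1 := csInf_le hBb (hstep D hD ε hεpos)
    have h2 : γ * (D + ε) ≤ γ * (sInf B + 2 * ε) := mul_le_mul_of_nonneg_left (by linarith) hγ0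
    have h3 : γ * ε ≤ ε := by nlinarith
    nlinarith
  have hZlim : Tendsto (fun t => Z t x u) atTop (𝓝 (p x u)) := by
    rw [Metric.tendsto_atTop']
    intro ε hε
    obtain ⟨D, hD, hlt⟩ := exists_lt_of_csInf_lt hBne (show sInf B < ε by linarith)
    obtain ⟨N, hN⟩ := eventually_atTop.1 hD
    exact ⟨N, fun t ht => by
      rw [Real.dist_eq]
      exact (hN t ht.le x u).trans_lt hlt⟩
  simpa using (hQZ x u).add hZlim

end StochasticApproximation

/-! ### Almost sure convergence of weighted noise series -/

section Martingale

variable {Ω : Type*} {mΩ : MeasurableSpace Ω} {μ : Measure Ω} [IsProbabilityMeasure μ]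
  {ℱ : Filtration ℕ mΩ} {a e : ℕ → Ω → ℝ} {C K : ℝ}

theorem integral_sq_mul_le (m : MeasurableSpace Ω) (hm : m ≤ mΩ) {b f : Ω → ℝ}
    (hb : Measurable[m] b) (hbK : ∀ ω, |b ω| ≤ K) (hf : MemLp f 2 μ)
    (hC : μ[fun ω => f ω ^ 2 | m] ≤ᵐ[μ] fun _ => C) :
    ∫ ω, (b ω * f ω) ^ 2 ∂μ ≤ C * ∫ ω, b ω ^ 2 ∂μ := by
  have hbsq : StronglyMeasurable[m] fun ω => b ω ^ 2 := (hb.pow_const 2).stronglyMeasurable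
  have hbound : ∀ ω, ‖b ω ^ 2‖ ≤ K ^ 2 := fun ω => by
    rw [Real.norm_eq_abs, abs_pow]
    exact pow_le_pow_left₀ (abs_nonneg _) (hbK ω) 2
  have hbi : Integrable (fun ω => b ω ^ 2) μ :=
    Integrable.of_bound (hbsq.mono hm).aestronglyMeasurable _ (ae_of_all _ hbound)
  have hpull : μ[(fun ω => b ω ^ 2) * fun ω => f ω ^ 2 | m] =ᵐ[μ]
      (fun ω => b ω ^ 2) * μ[fun ω => f ω ^ 2 | m] :=
    condExp_stronglyMeasurable_mul_of_bound hm hbsq hf.integrable_sq (K ^ 2) (ae_of_all _ hbound)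
  calc ∫ ω, (b ω * f ω) ^ 2 ∂μ
      = ∫ ω, ((fun ω => b ω ^ 2) * fun ω => f ω ^ 2) ω ∂μ := by
        simp only [mul_pow, Pi.mul_apply]
    _ = ∫ ω, (μ[(fun ω => b ω ^ 2) * fun ω => f ω ^ 2 | m]) ω ∂μ := (integral_condExp hm).symm
    _ ≤ ∫ ω, C * b ω ^ 2 ∂μ := by
        refine integral_mono_ae integrable_condExp (hbi.const_mul C) ?_
        filter_upwards [hpull, hC] with ω h1 h2
        rw [h1, Pi.mul_apply, mul_comm C]
        exact mul_le_mul_of_nonneg_left h2 (sq_nonneg _)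
    _ = C * ∫ ω, b ω ^ 2 ∂μ := integral_const_mul _ _

/-- The partial sums form a martingale with orthogonal increments, so their second moments are at
most `C * K`. This bounds them in L¹, and the martingale convergence theorem applies. -/
theorem ae_exists_tendsto_sum_mul_of_sum_sq_le (ha : ∀ t, Measurable[ℱ t] (a t))
    (hK : ∀ n ω, ∑ t ∈ Finset.range n, a t ω ^ 2 ≤ K)
    (he : ∀ t, Measurable[ℱ (t + 1)] (e t)) (heL2 : ∀ t, MemLp (e t) 2 μ)
    (hmean : ∀ t, μ[e t | ℱ t] =ᵐ[μ] 0)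
    (hvar : ∀ t, μ[fun ω => e t ω ^ 2 | ℱ t] ≤ᵐ[μ] fun _ => C) :
    ∀ᵐ ω ∂μ, ∃ l, Tendsto (fun n => ∑ t ∈ Finset.range n, a t ω * e t ω) atTop (𝓝 l) := by
  have hC : 0 ≤ C := by
    have h0 : 0 ≤ᵐ[μ] μ[fun ω => e 0 ω ^ 2 | ℱ 0] :=
      condExp_nonneg (ae_of_all _ fun ω => sq_nonneg _)
    obtain ⟨ω, h1, h2⟩ := (h0.and (hvar 0)).exists
    exact le_trans h1 h2
  have haK : ∀ t ω, |a t ω| ≤ Real.sqrt K := fun t ω => by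
    refine Real.abs_le_sqrt (le_trans ?_ (hK (t + 1) ω))
    exact Finset.single_le_sum (f := fun t => a t ω ^ 2) (fun i _ => sq_nonneg _)
      (Finset.self_mem_range_succ t)
  have ham : ∀ t, StronglyMeasurable[ℱ t] (a t) := fun t => (ha t).stronglyMeasurable
  have haeL2 : ∀ t, MemLp (fun ω => a t ω * e t ω) 2 μ := fun t =>
    (heL2 t).of_le_mul (c := Real.sqrt K)
      (((ham t).mono (ℱ.le t)).aestronglyMeasurable.mul (heL2 t).aestronglyMeasurable)
      (ae_of_all _ fun ω => by
        rw [norm_mul]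
        exact mul_le_mul_of_nonneg_right (haK t ω) (norm_nonneg _))
  set M : ℕ → Ω → ℝ := fun n ω => ∑ t ∈ Finset.range n, a t ω * e t ω with hM
  have hMsucc : ∀ n, M (n + 1) = M n + fun ω => a n ω * e n ω := fun n => by
    ext ω
    simp only [hM, Finset.sum_range_succ, Pi.add_apply]
  have hML2 : ∀ n, MemLp (M n) 2 μ := fun n => by
    induction n with
    | zero => simp [hM]
    | succ n ih => rw [hMsucc]; exact ih.add (haeL2 n)
  have hMadp : StronglyAdapted ℱ M := fun n => by
    refine Measurable.stronglyMeasurable ?_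
    refine Finset.measurable_sum _ fun t ht => ?_
    have ht' : t + 1 ≤ n := Finset.mem_range.1 ht
    exact ((ha t).mono (ℱ.mono (by omega)) le_rfl).mul ((he t).mono (ℱ.mono ht') le_rfl)
  have hinc : ∀ n, μ[fun ω => a n ω * e n ω | ℱ n] =ᵐ[μ] 0 := fun n => by
    filter_upwards [condExp_stronglyMeasurable_mul_of_bound (ℱ.le n) (ham n)
      ((heL2 n).integrable one_le_two) (Real.sqrt K) (ae_of_all _ (haK n)), hmean n] with ω h1 h2
    refine Eq.trans h1 ?_
    rw [Pi.mul_apply, h2, Pi.zero_apply, mul_zero]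
  have hmart : Martingale M ℱ μ := by
    refine martingale_of_condExp_sub_eq_zero_nat hMadp
      (fun n => (hML2 n).integrable one_le_two) fun n => ?_
    rw [hMsucc, add_sub_cancel_left]
    exact hinc n
  have hcross : ∀ n, ∫ ω, M n ω * (a n ω * e n ω) ∂μ = 0 := fun n => by
    have hint : Integrable (M n * fun ω => a n ω * e n ω) μ :=
      (hML2 n).integrable_mul (haeL2 n)
    have h1 := condExp_mul_of_stronglyMeasurable_left (hMadp n) hint
      ((haeL2 n).integrable one_le_two)
    have h2 := integral_condExp (μ := μ) (f := M n * fun ω => a n ω * e n ω) (ℱ.le n)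
    refine Eq.trans h2.symm (integral_eq_zero_of_ae ?_)
    filter_upwards [h1, hinc n] with ω h3 h4
    rw [h3, Pi.mul_apply, h4, Pi.zero_apply, mul_zero]
  have ha2i : ∀ t, Integrable (fun ω => a t ω ^ 2) μ := fun t =>
    (MemLp.of_bound (p := 2) ((ham t).mono (ℱ.le t)).aestronglyMeasurable _
      (ae_of_all _ (haK t))).integrable_sq
  have hMsq : ∀ n, ∫ ω, M n ω ^ 2 ∂μ ≤ C * ∫ ω, ∑ t ∈ Finset.range n, a t ω ^ 2 ∂μ := by
    intro n
    induction n with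
    | zero => simp [hM]
    | succ n ih =>
      have h1 : ∀ ω, M (n + 1) ω ^ 2 =
          M n ω ^ 2 + 2 * (M n ω * (a n ω * e n ω)) + (a n ω * e n ω) ^ 2 := fun ω => by
        rw [hMsucc, Pi.add_apply]
        ring
      have i1 : Integrable (fun ω => M n ω ^ 2) μ := (hML2 n).integrable_sq
      have i2 : Integrable (fun ω => 2 * (M n ω * (a n ω * e n ω))) μ :=
        ((hML2 n).integrable_mul (haeL2 n)).const_mul 2
      have i3 : Integrable (fun ω => (a n ω * e n ω) ^ 2) μ := (haeL2 n).integrable_sq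
      have i12 : Integrable (fun ω => M n ω ^ 2 + 2 * (M n ω * (a n ω * e n ω))) μ := i1.add i2
      simp only [h1, Finset.sum_range_succ]
      rw [integral_add i12 i3, integral_add i1 i2, integral_const_mul, hcross,
        integral_add (integrable_finsetSum _ fun t _ => ha2i t) (ha2i n)]
      have h2 := integral_sq_mul_le (ℱ n) (ℱ.le n) (ha n) (haK n) (heL2 n) (hvar n)
      linarith
  have hbdd : ∀ n, ∫ ω, ‖M n ω‖ ∂μ ≤ 1 + C * K := fun n => by
    have h1 : ∫ ω, ∑ t ∈ Finset.range n, a t ω ^ 2 ∂μ ≤ K := by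
      have := integral_mono (integrable_finsetSum (Finset.range n) fun t _ => ha2i t)
        (integrable_const K) (μ := μ) (hK n)
      simpa using this
    have h2 : ∫ ω, ‖M n ω‖ ∂μ ≤ ∫ ω, (1 + M n ω ^ 2) ∂μ := by
      refine integral_mono ((hML2 n).integrable one_le_two).norm
        ((integrable_const 1).add (hML2 n).integrable_sq) fun ω => ?_
      simp only [Real.norm_eq_abs]
      nlinarith [sq_nonneg (|M n ω| - 1), sq_abs (M n ω)]
    rw [integral_add (integrable_const 1) (hML2 n).integrable_sq] at h2
    have h3 := mul_le_mul_of_nonneg_left h1 hC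
    have h4 : ∫ _, (1 : ℝ) ∂μ = 1 := by simp
    linarith [hMsq n]
  refine hmart.submartingale.exists_ae_tendsto_of_bdd (R := (1 + C * K).toNNReal) fun n => ?_
  rw [eLpNorm_one_eq_lintegral_enorm, ← ofReal_integral_norm_eq_lintegral_enorm
    ((hML2 n).integrable one_le_two)]
  exact ENNReal.ofReal_le_ofReal (hbdd n)

theorem ae_exists_tendsto_sum_mul (ha : ∀ t, Measurable[ℱ t] (a t))
    (hasq : ∀ᵐ ω ∂μ, Summable fun t => a t ω ^ 2)
    (he : ∀ t, Measurable[ℱ (t + 1)] (e t)) (heL2 : ∀ t, MemLp (e t) 2 μ)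
    (hmean : ∀ t, μ[e t | ℱ t] =ᵐ[μ] 0)
    (hvar : ∀ t, μ[fun ω => e t ω ^ 2 | ℱ t] ≤ᵐ[μ] fun _ => C) :
    ∀ᵐ ω ∂μ, ∃ l, Tendsto (fun n => ∑ t ∈ Finset.range n, a t ω * e t ω) atTop (𝓝 l) := by
  -- the weights are cut off as soon as the sum of their squares exceeds `k`
  set G : ℕ → ℕ → Set Ω := fun k t => {ω | ∑ i ∈ Finset.range (t + 1), a i ω ^ 2 ≤ k} with hG
  have hGm : ∀ k t, MeasurableSet[ℱ t] (G k t) := fun k t =>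
    measurableSet_le (Finset.measurable_sum _ fun i hi =>
      ((ha i).mono (ℱ.mono (Nat.lt_succ_iff.1 (Finset.mem_range.1 hi))) le_rfl).pow_const 2)
      measurable_const
  have hcut : ∀ k : ℕ, ∀ n ω, ∑ t ∈ Finset.range n, ((G k t).indicator (a t) ω) ^ 2 ≤ k := by
    intro k n ω
    induction n with
    | zero => simp
    | succ n ih =>
      -- The cut-off at time `n` already counts `a n`, so the bound is never overshot: either the
      -- full sum through `n` is at most `k`, or the new term is 0.
      by_cases h : ω ∈ G k n
      · refine le_trans (Finset.sum_le_sum fun t _ => ?_) h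
        by_cases h' : ω ∈ G k t
        · rw [Set.indicator_of_mem h']
        · rw [Set.indicator_of_notMem h']
          simpa using sq_nonneg (a t ω)
      · rw [Finset.sum_range_succ, Set.indicator_of_notMem h]
        simpa using ih
  have hconv : ∀ᵐ ω ∂μ, ∀ k : ℕ, ∃ l, Tendsto
      (fun n => ∑ t ∈ Finset.range n, (G k t).indicator (a t) ω * e t ω) atTop (𝓝 l) :=
    ae_all_iff.2 fun k => ae_exists_tendsto_sum_mul_of_sum_sq_le
      (fun t => (ha t).indicator (hGm k t)) (hcut k) he heL2 hmean hvar
  filter_upwards [hconv, hasq] with ω h1 h2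
  obtain ⟨k, hk⟩ := exists_nat_ge (∑' t, a t ω ^ 2)
  have hmem : ∀ t, ω ∈ G k t := fun t =>
    (h2.sum_le_tsum _ fun i _ => sq_nonneg _).trans hk
  simpa only [Set.indicator_of_mem (hmem _)] using h1 k

end Martingale

/-! ### Q-learning along one fixed trajectory -/

section Pathwise

variable {S A : Type*} {γ : ℝ} {Q₀ : S → A → ℝ} {s : ℕ → S} {a : ℕ → A} {α r : ℕ → ℝ}

theorem qLearning_succ (t : ℕ) (x : S) (u : A) :
    qLearning γ Q₀ s a α r (t + 1) x u =
      (1 - entryStep s a α x u t) * qLearning γ Q₀ s a α r t x u +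
        entryStep s a α x u t *
          (r t + γ * ⨆ b : A, qLearning γ Q₀ s a α r t (s (t + 1)) b) := by
  simp only [qLearning, entryStep]
  split_ifs <;> ring

theorem entryStep_mem_Icc {t : ℕ} (hα : 0 ≤ α t ∧ α t ≤ 1) (x : S) (u : A) :
    0 ≤ entryStep s a α x u t ∧ entryStep s a α x u t ≤ 1 := by
  rw [entryStep]
  split_ifs
  · exact hα
  · exact ⟨le_rfl, zero_le_one⟩

/-- The weight vanishes unless `(x, u)` is the visited pair; this lets the targets be written at
`(x, u)`. -/
theorem entryStep_mul_visited (f : S → A → ℝ) (x : S) (u : A) (t : ℕ) :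
    entryStep s a α x u t * f (s t) (a t) = entryStep s a α x u t * f x u := by
  rw [entryStep]
  split_ifs with h
  · rw [h.1, h.2]
  · simp

theorem exists_forall_abs_le_of_tendsto {X U : Type*} [Finite X] [Finite U]
    {f : X → U → ℕ → ℝ} (h : ∀ x u, Tendsto (f x u) atTop (𝓝 0)) :
    ∃ D, ∀ x u t, |f x u t| ≤ D := by
  choose b hb using fun z : X × U => (h z.1 z.2).abs.bddAbove_range
  obtain ⟨D, hD⟩ := (Set.finite_range b).bddAbove
  exact ⟨D, fun x u t => (hb (x, u) ⟨t, rfl⟩).trans (hD ⟨(x, u), rfl⟩)⟩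

variable {R : S → A → ℝ}

theorem tendsto_rewardNoise (hα : ∀ t, 0 ≤ α t ∧ α t ≤ 1)
    (hsum : ∀ x u, Tendsto (fun n => ∑ t ∈ Finset.range n, entryStep s a α x u t) atTop atTop)
    (hr : ∀ x u, ∃ l, Tendsto (fun n => ∑ t ∈ Finset.range n,
      entryStep s a α x u t * (r t - R (s t) (a t))) atTop (𝓝 l)) (x : S) (u : A) :
    Tendsto (movingAverage (entryStep s a α x u) fun t => r t - R (s t) (a t)) atTop (𝓝 0) := by
  obtain ⟨l, hl⟩ := hr x u
  exact tendsto_movingAverage_zero (fun t => entryStep_mem_Icc (hα t) x u) (hsum x u) hl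

variable [Fintype S] [Fintype A] {M : DiscountedMDP S A}

/-- After subtracting the reward noise average, each update is a convex combination with a target
that stays in `[-D, D]`: the maximum over actions at the sampled state never exceeds the sup norm of
the table, so transition noise is harmless here. -/
theorem exists_forall_abs_qLearning_le (hα : ∀ t, 0 ≤ α t ∧ α t ≤ 1)
    (hsum : ∀ x u, Tendsto (fun n => ∑ t ∈ Finset.range n, entryStep s a α x u t) atTop atTop)
    (hr : ∀ x u, ∃ l, Tendsto (fun n => ∑ t ∈ Finset.range n,
      entryStep s a α x u t * (r t - R (s t) (a t))) atTop (𝓝 l)) :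
    ∃ K, ∀ t x u, |qLearning M.γ Q₀ s a α r t x u| ≤ K := by
  have : Nonempty A := ⟨a 0⟩
  set Q := qLearning M.γ Q₀ s a α r with hQ
  set c := entryStep s a α with hc
  set N : S → A → ℕ → ℝ := fun x u => movingAverage (c x u) fun t => r t - R (s t) (a t) with hN
  obtain ⟨n, hn⟩ := exists_forall_abs_le_of_tendsto (f := N)
    (tendsto_rewardNoise hα hsum hr)
  obtain ⟨k, hk⟩ := (Set.finite_range fun z : S × A => |R z.1 z.2|).bddAbove
  obtain ⟨i, hi⟩ := (Set.finite_range fun z : S × A => |Q₀ z.1 z.2|).bddAbove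
  have hγ : 0 < 1 - M.γ := sub_pos.2 M.γ_lt_one
  -- Large enough to contain the initial table and to satisfy `k + γ (D + n) ≤ D`.
  set D : ℝ := max i ((k + M.γ * n) / (1 - M.γ)) with hD
  have hfix : k + M.γ * (D + n) ≤ D := by
    have := (div_le_iff₀ hγ).1 (le_max_right i ((k + M.γ * n) / (1 - M.γ)))
    rw [← hD] at this
    linarith
  have hY : ∀ t x u, |Q t x u - N x u t| ≤ D := by
    intro t
    induction t with
    | zero =>
      intro x u
      simp only [hQ, hN, qLearning, movingAverage, sub_zero]
      exact le_trans (hi ⟨(x, u), rfl⟩) (le_max_left _ _)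
    | succ t ih =>
      intro x u
      have hrec : Q (t + 1) x u - N x u (t + 1) = (1 - c x u t) * (Q t x u - N x u t) +
          c x u t * (R x u + M.γ * ⨆ b, Q t (s (t + 1)) b) := by
        have h1 := entryStep_mul_visited (s := s) (a := a) (α := α) R x u t
        have h2 : Q (t + 1) x u = _ := qLearning_succ t x u
        have h3 : N x u (t + 1) = (1 - c x u t) * N x u t + c x u t * (r t - R (s t) (a t)) := rfl
        rw [h2, h3]
        linear_combination h1
      have hmax : |⨆ b, Q t (s (t + 1)) b| ≤ D + n := abs_ciSup_le fun b => by
        have := abs_add_le (Q t (s (t + 1)) b - N (s (t + 1)) b t) (N (s (t + 1)) b t)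
        rw [sub_add_cancel] at this
        linarith [ih (s (t + 1)) b, hn (s (t + 1)) b t]
      have htarget : |R x u + M.γ * ⨆ b, Q t (s (t + 1)) b| ≤ D := by
        refine (abs_add_le _ _).trans (le_trans ?_ hfix)
        rw [abs_mul, abs_of_nonneg M.γ_nonneg]
        exact add_le_add (hk ⟨(x, u), rfl⟩) (mul_le_mul_of_nonneg_left hmax M.γ_nonneg)
      obtain ⟨hc0, hc1⟩ := entryStep_mem_Icc (s := s) (a := a) (hα t) x u
      rw [hrec]
      refine (abs_add_le _ _).trans ?_
      rw [abs_mul, abs_mul, abs_of_nonneg hc0, abs_of_nonneg (sub_nonneg.2 hc1)]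
      have h1 := mul_le_mul_of_nonneg_left (ih x u) (sub_nonneg.2 hc1)
      have h2 := mul_le_mul_of_nonneg_left htarget hc0
      linarith
  refine ⟨D + n, fun t x u => ?_⟩
  have := abs_add_le (Q t x u - N x u t) (N x u t)
  rw [sub_add_cancel] at this
  linarith [hY t x u, hn x u t]

theorem tendsto_qLearning (hα : ∀ t, 0 ≤ α t ∧ α t ≤ 1)
    (hsum : ∀ x u, Tendsto (fun n => ∑ t ∈ Finset.range n, entryStep s a α x u t) atTop atTop)
    (hr : ∀ x u, ∃ l, Tendsto (fun n => ∑ t ∈ Finset.range n,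
      entryStep s a α x u t * (r t - R (s t) (a t))) atTop (𝓝 l))
    (hs : ∀ x u y, ∃ l, Tendsto (fun n => ∑ t ∈ Finset.range n,
      entryStep s a α x u t * (⨆ b, qLearning M.γ Q₀ s a α r t y b) *
        (Set.indicator {y} (fun _ => (1 : ℝ)) (s (t + 1)) - (M.trans (s t) (a t) y).toReal))
      atTop (𝓝 l)) (x : S) (u : A) :
    Tendsto (fun t => qLearning M.γ Q₀ s a α r t x u) atTop (𝓝 (M.optimalQ R x u)) := by
  have : Nonempty A := ⟨a 0⟩
  obtain ⟨k, hk⟩ := exists_forall_abs_qLearning_le (M := M) (Q₀ := Q₀) hα hsum hr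
  have hNlim := tendsto_rewardNoise hα hsum hr
  set Q := qLearning M.γ Q₀ s a α r with hQ
  set c := entryStep s a α with hc
  set N : S → A → ℕ → ℝ := fun x u => movingAverage (c x u) fun t => r t - R (s t) (a t) with hN
  set e : ℕ → ℝ := fun t => (⨆ b, Q t (s (t + 1)) b) -
    (M.trans (s t) (a t)).mean fun y => ⨆ b, Q t y b with he
  set W : S → A → ℕ → ℝ := fun x u => movingAverage (c x u) e with hW
  -- Splitting over the next state separates a factor known at time `t` from a centred indicator
  -- bounded by 1.
  have hsplit : ∀ t, e t = ∑ y, (⨆ b, Q t y b) *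
      (Set.indicator {y} (fun _ => (1 : ℝ)) (s (t + 1)) - (M.trans (s t) (a t) y).toReal) := by
    classical
    intro t
    simp only [mul_sub, Finset.sum_sub_distrib, Set.indicator_apply, Set.mem_singleton_iff,
      mul_ite, mul_one, mul_zero, Finset.sum_ite_eq, Finset.mem_univ, if_true, he, PMF.mean]
    congr 1
    exact Finset.sum_congr rfl fun y _ => mul_comm _ _
  have hWlim : ∀ x u, Tendsto (W x u) atTop (𝓝 0) := by
    intro x u
    choose l hl using hs x u
    refine tendsto_movingAverage_zero (fun t => entryStep_mem_Icc (hα t) x u) (hsum x u)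
      (l := ∑ y, l y) ?_
    convert tendsto_finsetSum Finset.univ fun y _ => hl y using 2 with n
    rw [Finset.sum_comm]
    refine Finset.sum_congr rfl fun t _ => ?_
    rw [hsplit, Finset.mul_sum]
    exact Finset.sum_congr rfl fun y _ => by ring
  obtain ⟨n, hn⟩ := exists_forall_abs_le_of_tendsto (f := N) hNlim
  obtain ⟨w, hw⟩ := exists_forall_abs_le_of_tendsto hWlim
  refine tendsto_of_perturbed_contraction M.γ_nonneg M.γ_lt_one (c := c)
    (T := M.bellman R) (Z := fun t x u => Q t x u - N x u t - M.γ * W x u t)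
    (K := k + n + M.γ * w)
    (fun x u t => entryStep_mem_Icc (hα t) x u) hsum (fun q D h x u => ?_)
    (fun t x u => ?_) (fun t x u => ?_) (fun x u => ?_) x u
  · have := M.abs_bellman_sub_bellman_le R h x u
    rwa [M.bellman_optimalQ R] at this
  · refine (abs_sub _ _).trans (add_le_add ((abs_sub _ _).trans
      (add_le_add (hk t x u) (hn x u t))) ?_)
    rw [abs_mul, abs_of_nonneg M.γ_nonneg]
    exact mul_le_mul_of_nonneg_left (hw x u t) M.γ_nonneg
  · have h1 := entryStep_mul_visited (s := s) (a := a) (α := α) R x u t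
    have h2 := entryStep_mul_visited (s := s) (a := a) (α := α)
      (fun x u => (M.trans x u).mean fun y => ⨆ b, Q t y b) x u t
    have h3 : Q (t + 1) x u = _ := qLearning_succ t x u
    have h4 : N x u (t + 1) = (1 - c x u t) * N x u t + c x u t * (r t - R (s t) (a t)) := rfl
    have h5 : W x u (t + 1) = (1 - c x u t) * W x u t + c x u t * e t := rfl
    simp only [h3, h4, h5, he, DiscountedMDP.bellman]
    linear_combination h1 + M.γ * h2
  · have h := (hNlim x u).add ((hWlim x u).const_mul M.γ)
    rw [mul_zero, add_zero] at h
    exact h.congr fun t => by ring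

end Pathwise

/-! ### Adaptedness of the iterates -/

section Measurability

variable {S A Ω : Type*} [MeasurableSpace S] [MeasurableSingletonClass S]
  [MeasurableSpace A] [MeasurableSingletonClass A]

theorem Measurable.eval_of_countable [Countable S] {_ : MeasurableSpace Ω} {g : S → Ω → ℝ}
    (hg : ∀ y, Measurable (g y)) {f : Ω → S} (hf : Measurable f) :
    Measurable fun ω => g (f ω) ω :=
  (measurable_from_prod_countable_right (f := fun z : S × Ω => g z.1 z.2) hg).comp
    (hf.prodMk measurable_id)

theorem measurable_entryStep {_ : MeasurableSpace Ω} {s : ℕ → Ω → S} {a : ℕ → Ω → A}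
    {α : ℕ → Ω → ℝ} {t : ℕ} (hs : Measurable (s t)) (ha : Measurable (a t))
    (hα : Measurable (α t)) (x : S) (u : A) :
    Measurable fun ω => entryStep (s · ω) (a · ω) (α · ω) x u t := by
  have hm : MeasurableSet {ω | x = s t ω ∧ u = a t ω} := by
    simp only [eq_comm (a := x), eq_comm (a := u)]
    exact (hs (measurableSet_singleton x)).inter (ha (measurableSet_singleton u))
  exact Measurable.ite hm hα measurable_const

theorem measurable_qLearning [Fintype S] [Fintype A] {mΩ : MeasurableSpace Ω}
    {ℱ : Filtration ℕ mΩ} {s : ℕ → Ω → S} {a : ℕ → Ω → A} {α r : ℕ → Ω → ℝ}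
    (hs : ∀ t, Measurable[ℱ t] (s t)) (ha : ∀ t, Measurable[ℱ t] (a t))
    (hα : ∀ t, Measurable[ℱ t] (α t)) (hr : ∀ t, Measurable[ℱ (t + 1)] (r t))
    (γ : ℝ) (Q₀ : S → A → ℝ) (t : ℕ) (x : S) (u : A) :
    Measurable[ℱ t] fun ω => qLearning γ Q₀ (s · ω) (a · ω) (α · ω) (r · ω) t x u := by
  induction t generalizing x u with
  | zero => exact measurable_const
  | succ t ih =>
    have hle : ℱ t ≤ ℱ (t + 1) := ℱ.mono t.le_succ
    have hc := (measurable_entryStep (hs t) (ha t) (hα t) x u).mono hle le_rfl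
    have hQ : ∀ y b, Measurable[ℱ (t + 1)] fun ω =>
        qLearning γ Q₀ (s · ω) (a · ω) (α · ω) (r · ω) t y b :=
      fun y b => (ih y b).mono hle le_rfl
    have hmax : Measurable[ℱ (t + 1)] fun ω =>
        ⨆ b, qLearning γ Q₀ (s · ω) (a · ω) (α · ω) (r · ω) t (s (t + 1) ω) b :=
      Measurable.eval_of_countable
        (g := fun y ω => ⨆ b, qLearning γ Q₀ (s · ω) (a · ω) (α · ω) (r · ω) t y b)
        (fun y => Measurable.iSup fun b => hQ y b) (hs (t + 1))
    simp only [qLearning_succ]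
    exact ((hc.const_sub 1).mul (hQ x u)).add (hc.mul ((hr t).add (hmax.const_mul γ)))

end Measurability

/-! ### Conditional moments of the transition noise -/

section Noise

variable {Ω : Type*} {m mΩ : MeasurableSpace Ω} {μ : Measure Ω} [IsProbabilityMeasure μ]

theorem condExp_indicator_sub_eq_zero (hm : m ≤ mΩ) {E : Set Ω}
    (hE : MeasurableSet E) {p : Ω → ℝ} (hp : Measurable[m] p) (hpi : Integrable p μ)
    (h : μ⟦E | m⟧ =ᵐ[μ] p) :
    μ[fun ω => E.indicator (fun _ => (1 : ℝ)) ω - p ω | m] =ᵐ[μ] 0 := by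
  have h1 := condExp_sub (m := m) (μ := μ) ((integrable_const (1 : ℝ)).indicator hE) hpi
  rw [condExp_of_stronglyMeasurable hm hp.stronglyMeasurable hpi] at h1
  refine EventuallyEq.trans h1 ?_
  filter_upwards [h] with ω h2
  rw [Pi.sub_apply, h2, sub_self, Pi.zero_apply]

theorem condExp_sq_le_of_abs_le_one (hm : m ≤ mΩ) {e : Ω → ℝ}
    (he : Measurable e) (hb : ∀ ω, |e ω| ≤ 1) : μ[fun ω => e ω ^ 2 | m] ≤ᵐ[μ] fun _ => 1 := by
  have hint : Integrable (fun ω => e ω ^ 2) μ :=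
    (MemLp.of_bound (p := 2) he.aestronglyMeasurable 1 (ae_of_all _ hb)).integrable_sq
  have h := condExp_mono (m := m) hint (integrable_const (1 : ℝ))
    (ae_of_all μ fun ω => (sq_le_one_iff_abs_le_one (e ω)).2 (hb ω))
  rwa [condExp_const hm] at h

end Noise

theorem mainTheorem1
    {S A Θ Ω : Type*}
    [Fintype S] [MeasurableSpace S] [MeasurableSingletonClass S]
    [Fintype A] [MeasurableSpace A] [MeasurableSingletonClass A]
    [MeasurableSpace Θ]
    {mΩ : MeasurableSpace Ω} (μ : Measure Ω) [IsProbabilityMeasure μ] (ℱ : Filtration ℕ mΩ)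
    (M : DiscountedMDP S A)
    -- the reward family, the true parameter and the estimates of it used at each time
    (R : Θ → S → A → ℝ) (hR : ∀ x u, Measurable fun θ => R θ x u)
    (B : Θ) (Best : ℕ → Ω → Θ) (hBest : ∀ t, Measurable[ℱ (t + 1)] (Best t))
    -- the trajectory
    (s : ℕ → Ω → S) (a : ℕ → Ω → A) (hsa : IsTrajectory M μ ℱ s a)
    -- the estimated reward is conditionally unbiased, with bounded conditional variance
    (hL2 : ∀ t, MemLp (fun ω => R (Best t ω) (s t ω) (a t ω)) 2 μ)
    (hunbiased : ∀ t, μ[fun ω => R (Best t ω) (s t ω) (a t ω) | ℱ t]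
      =ᵐ[μ] fun ω => R B (s t ω) (a t ω))
    (C : ℝ) (hvar : ∀ t, Var[fun ω => R (Best t ω) (s t ω) (a t ω); μ | ℱ t]
      ≤ᵐ[μ] fun _ => C)
    -- the step sizes
    (α : ℕ → Ω → ℝ) (hα : ∀ t, Measurable[ℱ t] (α t))
    (hα01 : ∀ t, ∀ᵐ ω ∂μ, 0 ≤ α t ω ∧ α t ω ≤ 1)
    (hαsum : ∀ x u, ∀ᵐ ω ∂μ, Tendsto
      (fun n => ∑ t ∈ Finset.range n, entryStep (s · ω) (a · ω) (α · ω) x u t) atTop atTop)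
    (hαsq : ∀ x u, ∀ᵐ ω ∂μ, Summable
      (fun t => (entryStep (s · ω) (a · ω) (α · ω) x u t) ^ 2))
    -- the initial table
    (Q₀ : S → A → ℝ) :
    ∀ᵐ ω ∂μ, ∀ x u, Tendsto
      (fun t => qLearning M.γ Q₀ (s · ω) (a · ω) (α · ω)
        (fun i => R (Best i ω) (s i ω) (a i ω)) t x u)
      atTop (𝓝 (M.optimalQ (R B) x u)) := by
  have hs := hsa.measurable_state
  have ha := hsa.measurable_action
  set r : ℕ → Ω → ℝ := fun t ω => R (Best t ω) (s t ω) (a t ω) with hr_def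
  have hvisit : ∀ (f : S → A → ℝ) t, Measurable[ℱ t] fun ω => f (s t ω) (a t ω) := fun f t =>
    (measurable_of_finite fun z : S × A => f z.1 z.2).comp ((hs t).prodMk (ha t))
  have hr : ∀ t, Measurable[ℱ (t + 1)] (r t) := fun t =>
    Measurable.eval_of_countable (g := fun (z : S × A) ω => R (Best t ω) z.1 z.2)
      (fun z => (hR z.1 z.2).comp (hBest t))
      (((hs t).prodMk (ha t)).mono (ℱ.mono t.le_succ) le_rfl)
  have hc : ∀ x u t, Measurable[ℱ t] fun ω => entryStep (s · ω) (a · ω) (α · ω) x u t :=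
    fun x u t => measurable_entryStep (hs t) (ha t) (hα t) x u
  have hQ := measurable_qLearning hs ha hα hr M.γ Q₀
  -- almost surely, the weighted reward noise is summable
  have hRL2 : ∀ t, MemLp (fun ω => R B (s t ω) (a t ω)) 2 μ := fun t => by
    obtain ⟨D, hD⟩ := (Set.finite_range fun z : S × A => |R B z.1 z.2|).bddAbove
    exact MemLp.of_bound ((hvisit (R B) t).mono (ℱ.le t) le_rfl).aestronglyMeasurable D
      (ae_of_all _ fun ω => hD ⟨(s t ω, a t ω), rfl⟩)
  have hrew : ∀ x u, ∀ᵐ ω ∂μ, ∃ l, Tendsto (fun n => ∑ t ∈ Finset.range n,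
      entryStep (s · ω) (a · ω) (α · ω) x u t * (r t ω - R B (s t ω) (a t ω)))
      atTop (𝓝 l) := fun x u => by
    refine ae_exists_tendsto_sum_mul (e := fun t ω => r t ω - R B (s t ω) (a t ω)) (hc x u)
      (hαsq x u) (fun t => (hr t).sub ((hvisit (R B) t).mono (ℱ.mono t.le_succ) le_rfl))
      (fun t => (hL2 t).sub (hRL2 t)) (fun t => ?_) (C := C) (fun t => ?_)
    · have h1 := condExp_sub (m := ℱ t) ((hL2 t).integrable one_le_two)
        ((hRL2 t).integrable one_le_two)
      rw [condExp_of_stronglyMeasurable (ℱ.le t) (hvisit (R B) t).stronglyMeasurable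
        ((hRL2 t).integrable one_le_two)] at h1
      refine EventuallyEq.trans h1 ?_
      filter_upwards [hunbiased t] with ω h2
      rw [Pi.sub_apply, h2, sub_self, Pi.zero_apply]
    -- Unbiasedness makes the true reward the centring used by the conditional variance.
    · have h1 : μ[fun ω => (r t ω - R B (s t ω) (a t ω)) ^ 2 | ℱ t] =ᵐ[μ]
          Var[r t; μ | ℱ t] := by
        refine condExp_congr_ae ?_
        filter_upwards [hunbiased t] with ω h2
        rw [Pi.pow_apply, Pi.sub_apply, h2]
      exact h1.le.trans (hvar t)
  -- hence the iterates are bounded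
  have hα01' : ∀ᵐ ω ∂μ, ∀ t, 0 ≤ α t ω ∧ α t ω ≤ 1 := ae_all_iff.2 hα01
  have hαsum' := ae_all_iff.2 fun x => ae_all_iff.2 (hαsum x)
  have hrew' := ae_all_iff.2 fun x => ae_all_iff.2 (hrew x)
  have hbdd : ∀ᵐ ω ∂μ, ∃ K, ∀ t x u,
      |qLearning M.γ Q₀ (s · ω) (a · ω) (α · ω) (r · ω) t x u| ≤ K := by
    filter_upwards [hα01', hαsum', hrew'] with ω h1 h2 h3
    exact exists_forall_abs_qLearning_le h1 h2 h3
  -- so that the weighted transition noise is summable too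
  have htrans : ∀ x u y, ∀ᵐ ω ∂μ, ∃ l, Tendsto (fun n => ∑ t ∈ Finset.range n,
      entryStep (s · ω) (a · ω) (α · ω) x u t *
        (⨆ b, qLearning M.γ Q₀ (s · ω) (a · ω) (α · ω) (r · ω) t y b) *
        (Set.indicator {y} (fun _ => (1 : ℝ)) (s (t + 1) ω) -
          (M.trans (s t ω) (a t ω) y).toReal)) atTop (𝓝 l) := fun x u y => by
    have hp : ∀ t, Measurable[ℱ t] fun ω => (M.trans (s t ω) (a t ω) y).toReal :=
      hvisit fun x u => (M.trans x u y).toReal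
    have hp1 : ∀ t ω, (M.trans (s t ω) (a t ω) y).toReal ≤ 1 := fun t ω =>
      ENNReal.toReal_mono ENNReal.one_ne_top (PMF.coe_le_one _ _)
    have he : ∀ t, Measurable[ℱ (t + 1)] fun ω => Set.indicator {y} (fun _ => (1 : ℝ))
        (s (t + 1) ω) - (M.trans (s t ω) (a t ω) y).toReal := fun t =>
      (((measurable_const.indicator (measurableSet_singleton y))).comp (hs (t + 1))).sub
        ((hp t).mono (ℱ.mono t.le_succ) le_rfl)
    have heb : ∀ t ω, |Set.indicator {y} (fun _ => (1 : ℝ)) (s (t + 1) ω) -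
        (M.trans (s t ω) (a t ω) y).toReal| ≤ 1 := fun t ω => by
      have h0 : 0 ≤ (M.trans (s t ω) (a t ω) y).toReal := ENNReal.toReal_nonneg
      have h1 := hp1 t ω
      by_cases h : s (t + 1) ω ∈ ({y} : Set S)
      · rw [Set.indicator_of_mem h, abs_le]
        constructor <;> linarith
      · rw [Set.indicator_of_notMem h, abs_le]
        constructor <;> linarith
    -- The table value goes into the predictable weight. Its bound depends on `ω`, so the squared
    -- weights are only almost surely summable, without a uniform bound.
    refine ae_exists_tendsto_sum_mul (ℱ := ℱ) (a := fun t ω =>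
      entryStep (s · ω) (a · ω) (α · ω) x u t *
        ⨆ b, qLearning M.γ Q₀ (s · ω) (a · ω) (α · ω) (r · ω) t y b)
      (fun t => (hc x u t).mul (Measurable.iSup fun b => hQ t y b)) ?_ he
      (fun t => MemLp.of_bound ((he t).mono (ℱ.le _) le_rfl).aestronglyMeasurable 1
        (ae_of_all _ (heb t))) (fun t => ?_) (C := 1)
      (fun t => condExp_sq_le_of_abs_le_one (ℱ.le t) ((he t).mono (ℱ.le _) le_rfl) (heb t))
    · filter_upwards [hbdd, hαsq x u] with ω ⟨K, hK⟩ h2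
      have : Nonempty A := ⟨u⟩
      refine Summable.of_nonneg_of_le (fun t => sq_nonneg _) (fun t => ?_) (h2.mul_right (K ^ 2))
      rw [mul_pow]
      refine mul_le_mul_of_nonneg_left ?_ (sq_nonneg _)
      rw [← sq_abs]
      exact pow_le_pow_left₀ (abs_nonneg _) (abs_ciSup_le fun b => hK t y b) 2
    · exact condExp_indicator_sub_eq_zero (ℱ.le t)
        ((hs (t + 1)).mono (ℱ.le _) le_rfl (measurableSet_singleton y)) (hp t)
        (Integrable.of_bound ((hp t).mono (ℱ.le t) le_rfl).aestronglyMeasurable 1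
          (ae_of_all _ fun ω => by
            rw [Real.norm_eq_abs, abs_of_nonneg ENNReal.toReal_nonneg]
            exact hp1 t ω))
        (hsa.condProb_next t y)
  have htrans' := ae_all_iff.2 fun x => ae_all_iff.2 fun u => ae_all_iff.2 (htrans x u)
  filter_upwards [hα01', hαsum', hrew', htrans'] with ω h1 h2 h3 h4 x u
  exact tendsto_qLearning h1 h2 h3 h4 x u
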